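/- Let $\mathbb X,\mathbb Y,\mathbb A$ be Borel subsets of Polish spaces with their Borel $\sigma$-fields, let $P(dx'|x,a)$ be a stochastic kernel on $\mathbb X$ given $\mathbb X\times\mathbb A$ and $Q(dy|a,x)$ a stochastic kernel on $\mathbb Y$ given $\mathbb A\times\mathbb X$. For a separable metrizable space $S$, let $\mathbb P(S)$ be the space of Borel probability measures on $S$ with the topology of weak convergence. For $z\in\mathbb P(\mathbb X)$, $a\in\mathbb A$ and Borel sets $B\subseteq\mathbb X$, $C\subseteq\mathbb Y$ put $$R(B\times C|z,a)=\int_{\mathbb X}\int_B Q(C|a,x')\,P(dx'|x,a)\,z(dx),\qquad R'(C|z,a)=R(\mathbb X\times C|z,a).$$ Call a stochastic kernel $H$ on $\mathbb X$ given $\mathbb P(\mathbb X)\times\mathbb A\times\mathbb Y$ a filtering kernel if $R(B\times C|z,a)=\int_C H(B|z,a,y)\,R'(dy|z,a)$ for all $B,C,z,a$. The transition kernel $q$ on $\mathbb P(\mathbb X)$ given $\mathbb P(\mathbb X)\times\mathbb A$ of the completely observable Markov decision process (COMDP) is $q(D|z,a)=\int_{\mathbb Y}\mathbf 1\{H(z,a,y)\in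 D\}\,R'(dy|z,a)$ for Borel $D\subseteq\mathbb P(\mathbb X)$, where $H$ is any filtering kernel and $H(z,a,y)=H(\,\cdot\,|z,a,y)$. A stochastic kernel $K(ds_1|s_2)$ is called weakly continuous, setwise continuous, or continuous in total variation if, whenever $s_2^{(n)}\to s_2$, one has respectively $\int f\,dK(\cdot|s_2^{(n)})\to\int f\,dK(\cdot|s_2)$ for every bounded continuous $f$; the same for every bounded Borel-measurable $f$; or $\sup_f\left(\int f\,dK(\cdot|s_2^{(n)})-\int f\,dK(\cdot|s_2)\right)\to0$, the supremum being over all Borel-measurable $f$ with values in $[-1,1]$. Assumption (H): there is a filtering kernel $H$ such that, whenever $z^{(n)}\to z$ weakly in $\mathbb P(\mathbb X)$ and $a^{(n)}\to a$ in $\mathbb A$, there are a subsequence $(z^{(n_k)},a^{(n_k)})$ and a measurable set $C\subseteq\mathbb Y$ with $R'(C|z,a)=1$ such that $H(z^{(n_k)},a^{(n_k)},y)\to H(z,a,y)$ weakly for all $y\in C$. Theorem. If $P$ is weakly continuous and $Q$ is continuous in total variation, then $R'$ is setwise continuous, and indeed continuous in total variation, and Assumption (H) holds; consequently, the transition kernel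 $q$ of the COMDP is weakly continuous, whichever filtering kernel $H$ is used to define it. -/

import Mathlib

open MeasureTheory ProbabilityTheory Filter Topology

namespace POMDP

/-! ## Probability measures on a separable metrizable space

`ProbabilityMeasure S` carries the topology of weak convergence and the sigma-algebra generated by
the evaluations `μ ↦ μ B`. The next instance shows that the latter is the Borel sigma-algebra of
the former, so that every kernel below is a Borel kernel. -/

theorem measurable_toMeasure_borel (S : Type*) [TopologicalSpace S]
    [TopologicalSpace.PseudoMetrizableSpace S] [MeasurableSpace S] [BorelSpace S] :
    Measurable[borel (ProbabilityMeasure S)]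
      (fun μ : ProbabilityMeasure S => (μ : Measure S)) := by
  let : MeasurableSpace (ProbabilityMeasure S) := borel _
  have : BorelSpace (ProbabilityMeasure S) := ⟨rfl⟩
  refine Measurable.measure_of_isPiSystem_of_isProbabilityMeasure
    (S := {s : Set S | IsOpen s}) (BorelSpace.measurable_eq (α := S)) isPiSystem_isOpen ?_
  intro G hG
  have hlsc : LowerSemicontinuous (fun μ : ProbabilityMeasure S => (μ : Measure S) G) := by
    intro μ
    refine lowerSemicontinuousAt_iff_le_liminf.2 ?_
    exact ProbabilityMeasure.le_liminf_measure_open_of_tendsto tendsto_id hG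
  exact hlsc.measurable

instance borelSpace_probabilityMeasure (S : Type*) [TopologicalSpace S]
    [TopologicalSpace.PseudoMetrizableSpace S] [SecondCountableTopology S]
    [MeasurableSpace S] [BorelSpace S] : BorelSpace (ProbabilityMeasure S) := by
  refine ⟨le_antisymm ?_ ?_⟩
  · exact (measurable_toMeasure_borel S).comap_le
  · let B := TopologicalSpace.countableBasis S
    have hBc : B.Countable := TopologicalSpace.countable_countableBasis S
    have hB : TopologicalSpace.IsTopologicalBasis B :=
      TopologicalSpace.isBasis_countableBasis S
    let F : Set (Set (Set S)) := {T | T.Finite ∧ T ⊆ B}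
    have hF : F.Countable := Set.countable_ofPred_finite_subset hBc
    let G : ℚ → Set (Set S) → Set (ProbabilityMeasure S) :=
      fun r T => {μ | Real.toNNReal r < μ (⋃₀ T)}
    let gen : Set (Set (ProbabilityMeasure S)) := Set.image2 G Set.univ F
    have hgen : gen.Countable := Set.countable_univ.image2 hF G
    let t' : TopologicalSpace (ProbabilityMeasure S) := TopologicalSpace.generateFrom gen
    have hsc : @SecondCountableTopology (ProbabilityMeasure S) t' := by
      let := t'
      exact ⟨⟨gen, hgen, rfl⟩⟩
    have hcont : t' ≤ ProbabilityMeasure.instTopologicalSpace := by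
      refine le_of_nhds_le_nhds fun μ => tendsto_id'.1 ?_
      have : (@nhds _ t' μ).IsCountablyGenerated := by
        let := t'
        infer_instance
      change Tendsto (fun ν => ν) (@nhds _ t' μ)
        (@nhds _ ProbabilityMeasure.instTopologicalSpace μ)
      refine tendsto_of_forall_isOpen_le_liminf (L := @nhds _ t' μ) fun U hU => ?_
      refine le_of_forall_lt fun c hc => ?_
      obtain ⟨d, hcd, hd⟩ := exists_between hc
      obtain ⟨T, hTB, hT, hTU⟩ := μ.exists_lt_measure_biUnion_of_isOpen (S := B)
        (fun u hu x hx => by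
          obtain ⟨s, hs, hxs, hsu⟩ := hB.exists_subset_of_mem_open hx hu
          exact ⟨s, hs, (hB.isOpen hs).mem_nhds hxs, hsu⟩) hU hd
      obtain ⟨r, hr0, hr1, hr2⟩ := NNReal.lt_iff_exists_rat_btwn _ _ |>.1 hT
      have hmem : G r (T : Set (Set S)) ∈ @nhds _ t' μ := by
        let := t'
        refine IsOpen.mem_nhds (TopologicalSpace.isOpen_generateFrom_of_mem
          ⟨r, trivial, T, ⟨T.finite_toSet, fun t ht => hTB t ht⟩, rfl⟩) ?_
        simpa [G, Set.sUnion_eq_biUnion] using hr2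
      refine lt_of_lt_of_le hcd (le_liminf_of_le ?_ ?_)
      · exact (isBoundedUnder_of ⟨1, by simp⟩ : IsBoundedUnder (· ≤ ·) _ _).isCoboundedUnder_ge
      · filter_upwards [hmem] with ν hν
        have h1 : ν (⋃₀ (T : Set (Set S))) ≤ ν U :=
          ν.apply_mono (by simpa [Set.sUnion_eq_biUnion] using hTU)
        exact (hr1.le.trans hν.le).trans h1
    have hb : @borel (ProbabilityMeasure S) t' = MeasurableSpace.generateFrom gen := by
      let := t'
      exact borel_eq_generateFrom_of_subbasis rfl
    have hle : @borel _ ProbabilityMeasure.instTopologicalSpace ≤ @borel _ t' :=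
      MeasurableSpace.generateFrom_mono fun u hu => hcont u hu
    refine (hle.trans hb.le).trans (MeasurableSpace.generateFrom_le ?_)
    rintro _ ⟨r, -, T, hT, rfl⟩
    have hTm : MeasurableSet (⋃₀ T) :=
      (isOpen_sUnion fun s hs => hB.isOpen (hT.2 hs)).measurableSet
    have hev : Measurable fun μ : ProbabilityMeasure S => μ (⋃₀ T) :=
      ((Measure.measurable_coe hTm).comp measurable_subtype_coe).ennreal_toNNReal
    exact measurableSet_lt measurable_const hev

/-! ## Stochastic kernels and their modes of continuity

A stochastic kernel on `S₁` given `S₂` is a `κ : Kernel S₂ S₁` with `IsMarkovKernel κ`. -/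

section Continuity

variable {S₁ S₂ : Type*} [MeasurableSpace S₁] [MeasurableSpace S₂]

/-- The value `κ(· | s)` of a stochastic kernel as an element of the space of probability
measures. -/
def law (κ : Kernel S₂ S₁) [IsMarkovKernel κ] (s : S₂) : ProbabilityMeasure S₁ :=
  ⟨κ s, inferInstance⟩

theorem measurable_law (κ : Kernel S₂ S₁) [IsMarkovKernel κ] : Measurable (law κ) :=
  κ.measurable.subtype_mk

/-- The total variation distance
`sup {∫ f dμ - ∫ f dν : f : S → [-1, 1] measurable}`. -/
noncomputable def tvDist (μ ν : Measure S₁) : ℝ :=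
  sSup {r : ℝ | ∃ f : S₁ → ℝ, Measurable f ∧ (∀ s, f s ∈ Set.Icc (-1 : ℝ) 1) ∧
    r = ∫ s, f s ∂μ - ∫ s, f s ∂ν}

/-- `κ(· | xₙ)` converges weakly to `κ(· | x)` whenever `xₙ → x`. -/
def WeaklyContinuous [TopologicalSpace S₁] [OpensMeasurableSpace S₁] [TopologicalSpace S₂]
    (κ : Kernel S₂ S₁) [IsMarkovKernel κ] : Prop :=
  ∀ (u : ℕ → S₂) (x : S₂), Tendsto u atTop (𝓝 x) →
    Tendsto (fun n => law κ (u n)) atTop (𝓝 (law κ x))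

/-- `κ(· | xₙ)` converges setwise to `κ(· | x)` whenever `xₙ → x`: integrals of bounded
measurable functions converge. -/
def SetwiseContinuous [TopologicalSpace S₂] (κ : Kernel S₂ S₁) [IsMarkovKernel κ] : Prop :=
  ∀ (u : ℕ → S₂) (x : S₂), Tendsto u atTop (𝓝 x) →
    ∀ f : S₁ → ℝ, Measurable f → (∃ M : ℝ, ∀ s, |f s| ≤ M) →
      Tendsto (fun n => ∫ s, f s ∂(κ (u n))) atTop (𝓝 (∫ s, f s ∂(κ x)))

/-- `κ(· | xₙ)` converges in total variation to `κ(· | x)` whenever `xₙ → x`. -/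
def TVContinuous [TopologicalSpace S₂] (κ : Kernel S₂ S₁) [IsMarkovKernel κ] : Prop :=
  ∀ (u : ℕ → S₂) (x : S₂), Tendsto u atTop (𝓝 x) →
    Tendsto (fun n => tvDist (κ (u n)) (κ x)) atTop (𝓝 0)

end Continuity

/-! ## The belief-state model

`P : Kernel (X × A) X` is the transition law and `Q : Kernel (A × X) Y` the observation kernel. -/

section Model

variable {X Y A : Type*} [MeasurableSpace X] [MeasurableSpace Y] [MeasurableSpace A]

/-- The kernel `(z, a) ↦ z` on `X` given `P(X) × A`. -/
noncomputable def stateKernel (X A : Type*) [MeasurableSpace X] [MeasurableSpace A] :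
    Kernel (ProbabilityMeasure X × A) X where
  toFun p := (p.1 : Measure X)
  measurable' := measurable_subtype_coe.comp measurable_fst

instance : IsMarkovKernel (stateKernel X A) :=
  ⟨fun p => inferInstanceAs (IsProbabilityMeasure (p.1 : Measure X))⟩

/-- The law of the next state, `(z, a) ↦ ∫ P(dx' | x, a) z(dx)`. -/
noncomputable def nextState (P : Kernel (X × A) X) [IsMarkovKernel P] :
    Kernel (ProbabilityMeasure X × A) X :=
  (stateKernel X A ⊗ₖ P.comap (fun p : (ProbabilityMeasure X × A) × X => (p.2, p.1.2))
    (by fun_prop)).snd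

instance (P : Kernel (X × A) X) [IsMarkovKernel P] : IsMarkovKernel (nextState P) := by
  unfold nextState; infer_instance

/-- The joint law `R` of the next state and the next observation; see `jointKernel_prod`. -/
noncomputable def jointKernel (P : Kernel (X × A) X) [IsMarkovKernel P]
    (Q : Kernel (A × X) Y) [IsMarkovKernel Q] : Kernel (ProbabilityMeasure X × A) (X × Y) :=
  nextState P ⊗ₖ Q.comap (fun p : (ProbabilityMeasure X × A) × X => (p.1.2, p.2)) (by fun_prop)

instance (P : Kernel (X × A) X) [IsMarkovKernel P] (Q : Kernel (A × X) Y) [IsMarkovKernel Q] :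
    IsMarkovKernel (jointKernel P Q) := by
  unfold jointKernel; infer_instance

/-- The law `R'` of the next observation; see `obsKernel_apply`. -/
noncomputable def obsKernel (P : Kernel (X × A) X) [IsMarkovKernel P]
    (Q : Kernel (A × X) Y) [IsMarkovKernel Q] : Kernel (ProbabilityMeasure X × A) Y :=
  (jointKernel P Q).snd

instance (P : Kernel (X × A) X) [IsMarkovKernel P] (Q : Kernel (A × X) Y) [IsMarkovKernel Q] :
    IsMarkovKernel (obsKernel P Q) := by
  unfold obsKernel; infer_instance

/-- `R(B × C | z, a) = ∫_X ∫_B Q(C | a, x') P(dx' | x, a) z(dx)`. -/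
theorem jointKernel_prod (P : Kernel (X × A) X) [IsMarkovKernel P]
    (Q : Kernel (A × X) Y) [IsMarkovKernel Q] (z : ProbabilityMeasure X) (a : A)
    {B : Set X} (hB : MeasurableSet B) {C : Set Y} (hC : MeasurableSet C) :
    jointKernel P Q (z, a) (B ×ˢ C) =
      ∫⁻ x, ∫⁻ x' in B, Q (a, x') C ∂(P (x, a)) ∂(z : Measure X) := by
  have hm : Measurable fun x' : X => Q (a, x') C :=
    (Q.measurable_coe hC).comp measurable_prodMk_left
  have h1 : jointKernel P Q (z, a) (B ×ˢ C) =
      ∫⁻ x' in B, Q (a, x') C ∂(nextState P (z, a)) :=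
    Kernel.compProd_apply_prod hB hC
  rw [h1, ← lintegral_indicator hB, nextState, Kernel.lintegral_snd _ _ (hm.indicator hB)]
  rw [Kernel.lintegral_compProd (f := fun p : X × X => B.indicator (fun x' => Q (a, x') C) p.2)
    _ _ _ ((hm.indicator hB).comp measurable_snd)]
  simp only [Kernel.comap_apply, lintegral_indicator hB]
  rfl

/-- `R'(C | z, a) = ∫_X ∫_X Q(C | a, x') P(dx' | x, a) z(dx)`. -/
theorem obsKernel_apply (P : Kernel (X × A) X) [IsMarkovKernel P]
    (Q : Kernel (A × X) Y) [IsMarkovKernel Q] (z : ProbabilityMeasure X) (a : A)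
    {C : Set Y} (hC : MeasurableSet C) :
    obsKernel P Q (z, a) C = ∫⁻ x, ∫⁻ x', Q (a, x') C ∂(P (x, a)) ∂(z : Measure X) := by
  have h := jointKernel_prod P Q z a MeasurableSet.univ hC
  simp only [Set.univ_prod, Measure.restrict_univ] at h
  rw [obsKernel, Kernel.snd_apply' _ _ hC]
  exact h

/-- `H` is a filtering kernel:
`R(B × C | z, a) = ∫_C H(B | z, a, y) R'(dy | z, a)`. -/
def IsFilteringKernel (P : Kernel (X × A) X) [IsMarkovKernel P]
    (Q : Kernel (A × X) Y) [IsMarkovKernel Q]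
    (H : Kernel (ProbabilityMeasure X × A × Y) X) : Prop :=
  ∀ (z : ProbabilityMeasure X) (a : A) (B : Set X) (C : Set Y),
    MeasurableSet B → MeasurableSet C →
      jointKernel P Q (z, a) (B ×ˢ C) = ∫⁻ y in C, H (z, a, y) B ∂(obsKernel P Q (z, a))

/-- Assumption (H). -/
def AssumptionH [TopologicalSpace X] [OpensMeasurableSpace X] [TopologicalSpace A]
    (P : Kernel (X × A) X) [IsMarkovKernel P] (Q : Kernel (A × X) Y) [IsMarkovKernel Q] : Prop :=
  ∃ (H : Kernel (ProbabilityMeasure X × A × Y) X) (_ : IsMarkovKernel H),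
    IsFilteringKernel P Q H ∧
      ∀ (zs : ℕ → ProbabilityMeasure X) (z : ProbabilityMeasure X) (as : ℕ → A) (a : A),
        Tendsto zs atTop (𝓝 z) → Tendsto as atTop (𝓝 a) →
          ∃ φ : ℕ → ℕ, StrictMono φ ∧ ∃ C : Set Y, MeasurableSet C ∧
            obsKernel P Q (z, a) C = 1 ∧
              ∀ y ∈ C, Tendsto (fun k => law H (zs (φ k), as (φ k), y)) atTop
                (𝓝 (law H (z, a, y)))

/-- The transition kernel `q` on `P(X)` given `P(X) × A` that a filtering kernel `H` defines:
`q(· | z, a)` is the law of `H(z, a, y)` for `y` distributed as `R'(· | z, a)`;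
see `beliefKernel_apply`. -/
noncomputable def beliefKernel (P : Kernel (X × A) X) [IsMarkovKernel P]
    (Q : Kernel (A × X) Y) [IsMarkovKernel Q]
    (H : Kernel (ProbabilityMeasure X × A × Y) X) [IsMarkovKernel H] :
    Kernel (ProbabilityMeasure X × A) (ProbabilityMeasure X) :=
  (Kernel.id ×ₖ obsKernel P Q).map
    (fun p : (ProbabilityMeasure X × A) × Y => law H (p.1.1, p.1.2, p.2))

theorem measurable_law_assoc (H : Kernel (ProbabilityMeasure X × A × Y) X) [IsMarkovKernel H] :
    Measurable fun p : (ProbabilityMeasure X × A) × Y => law H (p.1.1, p.1.2, p.2) :=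
  (measurable_law H).comp (by fun_prop)

instance (P : Kernel (X × A) X) [IsMarkovKernel P] (Q : Kernel (A × X) Y) [IsMarkovKernel Q]
    (H : Kernel (ProbabilityMeasure X × A × Y) X) [IsMarkovKernel H] :
    IsMarkovKernel (beliefKernel P Q H) :=
  Kernel.IsMarkovKernel.map _ (measurable_law_assoc H)

/-- `q(D | z, a) = ∫ 1{H(z, a, y) ∈ D} R'(dy | z, a)`. -/
theorem beliefKernel_apply (P : Kernel (X × A) X) [IsMarkovKernel P]
    (Q : Kernel (A × X) Y) [IsMarkovKernel Q]
    (H : Kernel (ProbabilityMeasure X × A × Y) X) [IsMarkovKernel H]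
    (z : ProbabilityMeasure X) (a : A) {D : Set (ProbabilityMeasure X)} (hD : MeasurableSet D) :
    beliefKernel P Q H (z, a) D =
      ∫⁻ y, Set.indicator {y | law H (z, a, y) ∈ D} 1 y ∂(obsKernel P Q (z, a)) := by
  have hm := measurable_law_assoc H
  have hs : MeasurableSet {y : Y | law H (z, a, y) ∈ D} :=
    (hm.comp (measurable_prodMk_left (x := (z, a)))) hD
  rw [lintegral_indicator_one hs, beliefKernel, Kernel.map_apply' _ hm _ hD,
    Kernel.prod_apply, Kernel.id_apply, Measure.prod_apply (hm hD),
    lintegral_dirac' _ (measurable_measure_prodMk_left (hm hD))]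
  rfl

end Model

end POMDP

/-! Fix a continuous f with |f| ≤ 1, and let g range over measurable functions into [-1, 1]. Then ∫
f(x) g(y) R(dx dy | z, a) is the integral of h_g(b, x') = f(x') ∫ g dQ(b, x') against the product of
δ_a and the law of the next state. Weak continuity of P makes this product weakly continuous in (z,
a). Total variation continuity of Q makes the bounded family (h_g) equicontinuous. Weak convergence
is uniform over such a family (`tendstoUniformly_integral_of_equicontinuous`), so the integrals
converge uniformly in g (`tendstoUniformly_integral_jointKernel`). The case f = 1 is total variation
continuity of R'.

For any filtering kernel H the same integral is ∫ g(y) (∫ f dH(z, a, y)) R'(dy | z, a). Testing with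
g the sign of the difference of two filtered expectations, and replacing R' at the moving point by
R' at the limit, gives L¹ convergence of the filtered expectations
(`IsFilteringKernel.tendsto_integral_abs_sub`). Countably many f determine weak convergence, so a
diagonal subsequence of the filters converges weakly almost surely, which is the property in (H).
Existence of H is a disintegration of R, and weak continuity of q follows by dominated convergence
along subsequences. -/

namespace POMDP

/-! ### Weak convergence: uniformity over families and countable test sequences -/

/-- Weak convergence is uniform over uniformly bounded equicontinuous families. -/
theorem tendstoUniformly_integral_of_equicontinuous {S ι : Type*} [TopologicalSpace S]
    [TopologicalSpace.MetrizableSpace S] [SecondCountableTopology S] [MeasurableSpace S]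
    [BorelSpace S] {h : ι → S → ℝ} (hequi : Equicontinuous h) (hb : ∀ i s, |h i s| ≤ 1)
    {μs : ℕ → ProbabilityMeasure S} {μ : ProbabilityMeasure S} (hμ : Tendsto μs atTop (𝓝 μ)) :
    TendstoUniformly (fun n i => ∫ s, h i s ∂(μs n : Measure S))
      (fun i => ∫ s, h i s ∂(μ : Measure S)) atTop := by
  classical
  let : MetricSpace S := TopologicalSpace.metrizableSpaceMetric S
  rw [Metric.tendstoUniformly_iff]
  intro ε hε
  -- The five δ: oscillation and missing mass under μ, the same two under μs n, and the change of
  -- the finite sum.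
  obtain ⟨δ, hδ, hδε⟩ : ∃ δ > 0, 5 * δ < ε := ⟨ε / 6, by positivity, by linarith⟩
  have hnhds : ∀ s : S, interior {t | ∀ i, dist (h i s) (h i t) < δ} ∈ 𝓝 s := fun s =>
    interior_mem_nhds.2 (Metric.equicontinuousAt_iff_right.1 (hequi s) δ hδ)
  obtain ⟨c, hc, hcov⟩ := TopologicalSpace.countable_cover_nhds hnhds
  have : Countable c := hc.to_subtype
  -- On the support of ρ j every h i is within δ of its value at the centre j, so one partition of
  -- unity discretises the whole family at once.
  obtain ⟨ρ, hρ⟩ := PartitionOfUnity.exists_isSubordinate (isClosed_univ (X := S))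
    (fun s : c => interior {t | ∀ i, dist (h i s) (h i t) < δ}) (fun _ => isOpen_interior)
    (by rw [← hcov, Set.biUnion_eq_iUnion])
  have hclose : ∀ (j : c) (t : S) (i : ι), ρ j t * |h i t - h i j| ≤ ρ j t * δ := by
    intro j t i
    by_cases hj : ρ j t = 0
    · simp [hj]
    · have ht := interior_subset (hρ j (subset_tsupport _ hj)) i
      rw [dist_comm, Real.dist_eq] at ht
      exact mul_le_mul_of_nonneg_left ht.le (ρ.nonneg j t)
  have hint : ∀ (ν : ProbabilityMeasure S) (j : c), Integrable (ρ j) (ν : Measure S) := by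
    intro ν j
    refine .of_bound (ρ j).continuous.aestronglyMeasurable 1 (ae_of_all _ fun t => ?_)
    rw [Real.norm_of_nonneg (ρ.nonneg j t)]
    exact ρ.le_one j t
  have hinth : ∀ (ν : ProbabilityMeasure S) (i : ι), Integrable (h i) (ν : Measure S) :=
    fun ν i => .of_bound (hequi.continuous i).aestronglyMeasurable 1 (ae_of_all _ fun t => hb i t)
  have hle1 : ∀ (I : Finset c) (t : S), ∑ j ∈ I, ρ j t ≤ 1 := by
    intro I t
    rw [← ρ.sum_finsupport' (Set.mem_univ t) (Finset.subset_union_left (s₂ := I))]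
    exact Finset.sum_le_sum_of_subset_of_nonneg Finset.subset_union_right
      fun j _ _ => ρ.nonneg j t
  have happrox : ∀ (I : Finset c) (ν : ProbabilityMeasure S) (i : ι),
      |∫ t, h i t ∂(ν : Measure S) - ∑ j ∈ I, h i j * ∫ t, ρ j t ∂(ν : Measure S)| ≤
        δ + (1 - ∑ j ∈ I, ∫ t, ρ j t ∂(ν : Measure S)) := by
    intro I ν i
    have hI : Integrable (fun t => ∑ j ∈ I, ρ j t) (ν : Measure S) :=
      integrable_finsetSum _ fun j _ => hint ν j
    have e1 : ∑ j ∈ I, h i j * ∫ t, ρ j t ∂(ν : Measure S) =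
        ∫ t, ∑ j ∈ I, h i j * ρ j t ∂(ν : Measure S) := by
      rw [integral_finsetSum _ fun j _ => (hint ν j).const_mul _]
      simp only [integral_const_mul]
    have e2 : δ + (1 - ∑ j ∈ I, ∫ t, ρ j t ∂(ν : Measure S)) =
        ∫ t, (δ + (1 - ∑ j ∈ I, ρ j t)) ∂(ν : Measure S) := by
      have h1 : Integrable (fun t => 1 - ∑ j ∈ I, ρ j t) (ν : Measure S) :=
        (integrable_const _).sub hI
      rw [integral_add (integrable_const _) h1, integral_sub (integrable_const _) hI,
        integral_finsetSum _ fun j _ => hint ν j]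
      simp
    rw [e1, e2, ← integral_sub (hinth ν i)
      (integrable_finsetSum _ fun j _ => (hint ν j).const_mul _)]
    refine abs_integral_le_integral_abs.trans (integral_mono_of_nonneg
      (ae_of_all _ fun _ => abs_nonneg _)
      ((integrable_const _).add ((integrable_const _).sub hI)) (ae_of_all _ fun t => ?_))
    have e3 : h i t - ∑ j ∈ I, h i j * ρ j t =
        ∑ j ∈ I, ρ j t * (h i t - h i j) + (1 - ∑ j ∈ I, ρ j t) * h i t := by
      simp only [mul_sub, Finset.sum_sub_distrib, ← Finset.sum_mul, mul_comm (h i _)]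
      ring
    have h1 : |∑ j ∈ I, ρ j t * (h i t - h i j)| ≤ δ := by
      calc |∑ j ∈ I, ρ j t * (h i t - h i j)| ≤ ∑ j ∈ I, |ρ j t * (h i t - h i j)| :=
            Finset.abs_sum_le_sum_abs _ _
        _ ≤ ∑ j ∈ I, ρ j t * δ := Finset.sum_le_sum fun j _ => by
            rw [abs_mul, abs_of_nonneg (ρ.nonneg j t)]; exact hclose j t i
        _ ≤ δ := by
            rw [← Finset.sum_mul]; exact mul_le_of_le_one_left hδ.le (hle1 I t)
    have h2 : |(1 - ∑ j ∈ I, ρ j t) * h i t| ≤ 1 - ∑ j ∈ I, ρ j t := by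
      have h0 : 0 ≤ 1 - ∑ j ∈ I, ρ j t := sub_nonneg.2 (hle1 I t)
      rw [abs_mul, abs_of_nonneg h0]
      exact mul_le_of_le_one_right h0 (hb i t)
    simp only [e3]
    exact (abs_add_le _ _).trans (add_le_add h1 h2)
  have hfull : Tendsto (fun I : Finset c => ∑ j ∈ I, ∫ t, ρ j t ∂(μ : Measure S)) atTop
      (𝓝 1) := by
    have h1 : Tendsto (fun I : Finset c => ∫ t, ∑ j ∈ I, ρ j t ∂(μ : Measure S)) atTop
        (𝓝 (∫ _, (1 : ℝ) ∂(μ : Measure S))) := by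
      refine tendsto_integral_filter_of_dominated_convergence (fun _ => (1 : ℝ))
        (.of_forall fun I => (integrable_finsetSum _ fun j _ => hint μ j).aestronglyMeasurable)
        (.of_forall fun I => ae_of_all _ fun t => ?_) (integrable_const _)
        (ae_of_all _ fun t => ?_)
      · rw [Real.norm_of_nonneg (Finset.sum_nonneg fun j _ => ρ.nonneg j t)]
        exact hle1 I t
      · refine tendsto_const_nhds.congr' ?_
        filter_upwards [eventually_ge_atTop (ρ.finsupport t)] with I hI
        exact (ρ.sum_finsupport' (Set.mem_univ t) hI).symm
    simpa [integral_finsetSum _ fun j _ => hint μ j] using h1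
  -- Finitely many ρ j carry all but δ of the mass of μ, and hence, by convergence of their
  -- integrals, of μs n for large n. This replaces tightness.
  obtain ⟨I, hI⟩ := (hfull.eventually (lt_mem_nhds (show 1 - δ < 1 by linarith))).exists
  have hconv : ∀ j : c, Tendsto (fun n => ∫ t, ρ j t ∂(μs n : Measure S)) atTop
      (𝓝 (∫ t, ρ j t ∂(μ : Measure S))) := by
    intro j
    exact ProbabilityMeasure.tendsto_iff_forall_integral_tendsto.1 hμ
      (BoundedContinuousFunction.ofNormedAddCommGroup (ρ j) (ρ j).continuous 1 fun t => by
        rw [Real.norm_of_nonneg (ρ.nonneg j t)]; exact ρ.le_one j t)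
  have hsum := tendsto_finsetSum I fun j _ => hconv j
  have hdiff : Tendsto (fun n => ∑ j ∈ I, |∫ t, ρ j t ∂(μs n : Measure S) -
      ∫ t, ρ j t ∂(μ : Measure S)|) atTop (𝓝 0) := by
    have := tendsto_finsetSum I fun j _ => ((hconv j).sub_const (∫ t, ρ j t ∂(μ : Measure S))).abs
    simpa using this
  filter_upwards [hsum.eventually (lt_mem_nhds hI), hdiff.eventually (gt_mem_nhds hδ)] with n h1 h2
  intro i
  have a1 := happrox I μ i
  have a2 := happrox I (μs n) i
  have a3 : |∑ j ∈ I, h i j * ∫ t, ρ j t ∂(μs n : Measure S) -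
      ∑ j ∈ I, h i j * ∫ t, ρ j t ∂(μ : Measure S)| ≤ δ := by
    rw [← Finset.sum_sub_distrib]
    refine (Finset.abs_sum_le_sum_abs _ _).trans (le_trans (Finset.sum_le_sum fun j _ => ?_) h2.le)
    rw [← mul_sub, abs_mul]
    exact mul_le_of_le_one_left (abs_nonneg _) (hb i j)
  rw [Real.dist_eq]
  rw [abs_le] at a1 a2 a3
  rw [abs_lt]
  constructor <;> linarith [a1.1, a1.2, a2.1, a2.2, a3.1, a3.2]

/-- A separable metrizable space carries a sequence of continuous functions into `[0, 1]` whose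
integrals determine weak convergence of probability measures. -/
theorem exists_seq_convergence_determining (S : Type*) [TopologicalSpace S]
    [TopologicalSpace.MetrizableSpace S] [SecondCountableTopology S] [MeasurableSpace S]
    [BorelSpace S] :
    ∃ f : ℕ → S → ℝ, (∀ k, Continuous (f k)) ∧ (∀ k s, f k s ∈ Set.Icc (0 : ℝ) 1) ∧
      ∀ (μs : ℕ → ProbabilityMeasure S) (μ : ProbabilityMeasure S),
        (∀ k, Tendsto (fun n => ∫ s, f k s ∂(μs n : Measure S)) atTop
          (𝓝 (∫ s, f k s ∂(μ : Measure S)))) → Tendsto μs atTop (𝓝 μ) := by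
  let B := TopologicalSpace.countableBasis S
  have hB : TopologicalSpace.IsTopologicalBasis B := TopologicalSpace.isBasis_countableBasis S
  let ι := {T : Set (Set S) // T.Finite ∧ T ⊆ B}
  have : Countable ι :=
    (Set.countable_ofPred_finite_subset (TopologicalSpace.countable_countableBasis S)).to_subtype
  have : Nonempty ι := ⟨⟨∅, Set.finite_empty, Set.empty_subset _⟩⟩
  have hcl : ∀ T : ι, IsClosed (⋃₀ T.1)ᶜ := fun T =>
    (isOpen_sUnion fun s hs => hB.isOpen (T.2.2 hs)).isClosed_compl
  -- The test functions approximate from above the indicators of complements of finite unions of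
  -- basic open sets; there are countably many.
  obtain ⟨e, he⟩ := exists_surjective_nat (ι × ℕ)
  refine ⟨fun k s => (hcl (e k).1).apprSeq (e k).2 s, fun k => ?_, fun k s => ⟨?_, ?_⟩, ?_⟩
  · exact NNReal.continuous_coe.comp (BoundedContinuousFunction.continuous _)
  · exact NNReal.coe_nonneg _
  · exact_mod_cast HasOuterApproxClosed.apprSeq_apply_le_one (hcl (e k).1) (e k).2 s
  intro μs μ hconv
  have hconv' : ∀ (T : ι) (m : ℕ),
      Tendsto (fun n => ∫⁻ s, (hcl T).apprSeq m s ∂(μs n : Measure S)) atTop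
        (𝓝 (∫⁻ s, (hcl T).apprSeq m s ∂(μ : Measure S))) := by
    intro T m
    obtain ⟨k, hk⟩ := he (T, m)
    have h1 := hconv k
    simp only [hk] at h1
    have h2 : ∀ ν : ProbabilityMeasure S, ∫⁻ s, (hcl T).apprSeq m s ∂(ν : Measure S) =
        ENNReal.ofReal (∫ s, ((hcl T).apprSeq m s : ℝ) ∂(ν : Measure S)) := by
      intro ν
      rw [ofReal_integral_eq_lintegral_ofReal (f := fun s => ((hcl T).apprSeq m s : ℝ))
        (BoundedContinuousFunction.integrable_of_nnreal _ _)
        (ae_of_all _ fun _ => NNReal.coe_nonneg _)]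
      simp
    simp only [h2]
    exact ENNReal.tendsto_ofReal h1
  have hlimsup : ∀ T : ι, limsup (fun n => (μs n : Measure S) (⋃₀ T.1)ᶜ) atTop ≤
      (μ : Measure S) (⋃₀ T.1)ᶜ := by
    intro T
    refine ge_of_tendsto' (HasOuterApproxClosed.tendsto_lintegral_apprSeq (hcl T) (μ : Measure S))
      fun m => ?_
    rw [← (hconv' T m).limsup_eq]
    exact limsup_le_limsup (.of_forall fun n =>
      HasOuterApproxClosed.measure_le_lintegral (hcl T) (μs n : Measure S) m)
  have hliminf : ∀ T : ι, (μ : Measure S) (⋃₀ T.1) ≤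
      liminf (fun n => (μs n : Measure S) (⋃₀ T.1)) atTop := fun T =>
    le_measure_liminf_of_limsup_measure_compl_le
      (isOpen_sUnion fun s hs => hB.isOpen (T.2.2 hs)).measurableSet (hlimsup T)
  -- By inner approximation, a finite union of basic sets inside U already has measure above any a <
  -- μ U, so the liminf inequality for such unions suffices.
  refine tendsto_of_forall_isOpen_le_liminf' fun U hU => le_of_forall_lt fun a ha => ?_
  obtain ⟨b, hb⟩ : ∃ b : NNReal, (b : ENNReal) = a := by
    lift a to NNReal using ha.ne_top
    exact ⟨a, rfl⟩
  have hb' : b < μ U := by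
    rw [← hb, ← ProbabilityMeasure.ennreal_coeFn_eq_coeFn_toMeasure] at ha
    exact_mod_cast ha
  obtain ⟨T, hTB, hT, hTU⟩ := μ.exists_lt_measure_biUnion_of_isOpen (S := B)
    (fun u hu x hx => by
      obtain ⟨s, hs, hxs, hsu⟩ := hB.exists_subset_of_mem_open hx hu
      exact ⟨s, hs, (hB.isOpen hs).mem_nhds hxs, hsu⟩) hU hb'
  have hT' : a < (μ : Measure S) (⋃₀ (T : Set (Set S))) := by
    rw [← hb, Set.sUnion_eq_biUnion, ← ProbabilityMeasure.ennreal_coeFn_eq_coeFn_toMeasure]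
    exact_mod_cast hT
  refine (hT'.trans_le (hliminf ⟨T, T.finite_toSet, fun t ht => hTB t ht⟩)).trans_le ?_
  refine liminf_le_liminf (.of_forall fun n => measure_mono ?_)
  rw [Set.sUnion_eq_biUnion]
  exact hTU

/-! ### Total variation distance and continuity of kernels -/

theorem integrable_of_abs_le {S : Type*} [MeasurableSpace S] {μ : Measure S} [IsFiniteMeasure μ]
    {f : S → ℝ} {M : ℝ} (hf : Measurable f) (hM : ∀ s, |f s| ≤ M) : Integrable f μ :=
  .of_bound hf.aestronglyMeasurable M (ae_of_all _ fun s => (Real.norm_eq_abs _).trans_le (hM s))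

theorem abs_integral_le_of_abs_le {S : Type*} [MeasurableSpace S] (μ : Measure S)
    [IsProbabilityMeasure μ] {f : S → ℝ} {M : ℝ} (hM : ∀ s, |f s| ≤ M) :
    |∫ s, f s ∂μ| ≤ M := by
  simpa using norm_integral_le_of_norm_le_const (μ := μ) (f := f) (ae_of_all _ hM)

/-- The measurable functions with values in `[-1, 1]`, over which `tvDist` is a supremum. -/
def UnitFun (S : Type*) [MeasurableSpace S] : Type _ :=
  {g : S → ℝ // Measurable g ∧ ∀ s, g s ∈ Set.Icc (-1 : ℝ) 1}

namespace UnitFun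

variable {S : Type*} [MeasurableSpace S]

theorem abs_le (g : UnitFun S) (s : S) : |g.1 s| ≤ 1 := _root_.abs_le.2 (g.2.2 s)

end UnitFun

theorem tvDist_le {S : Type*} [MeasurableSpace S] {μ ν : Measure S} {c : ℝ}
    (h : ∀ g : UnitFun S, ∫ s, g.1 s ∂μ - ∫ s, g.1 s ∂ν ≤ c) :
    tvDist μ ν ≤ c := by
  refine csSup_le ⟨_, fun _ => 0, measurable_const, by simp, rfl⟩ ?_
  rintro _ ⟨f, hf, hf1, rfl⟩
  exact h ⟨f, hf, hf1⟩

section TotalVariation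

variable {S : Type*} [MeasurableSpace S] (μ ν : Measure S)
  [IsProbabilityMeasure μ] [IsProbabilityMeasure ν]

theorem integral_sub_integral_le_tvDist {f : S → ℝ} (hf : Measurable f) (h1 : ∀ s, |f s| ≤ 1) :
    ∫ s, f s ∂μ - ∫ s, f s ∂ν ≤ tvDist μ ν := by
  -- The bound 2 is essential: a real `sSup` over an unbounded set would be the default value 0.
  refine le_csSup ⟨2, ?_⟩ ⟨f, hf, fun s => abs_le.1 (h1 s), rfl⟩
  rintro _ ⟨g, -, hg, rfl⟩
  have hμ := abs_le.1 (abs_integral_le_of_abs_le μ fun s => abs_le.2 (hg s))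
  have hν := abs_le.1 (abs_integral_le_of_abs_le ν fun s => abs_le.2 (hg s))
  linarith [hμ.2, hν.1]

theorem abs_integral_sub_integral_le_tvDist {f : S → ℝ} (hf : Measurable f)
    (h1 : ∀ s, |f s| ≤ 1) : |∫ s, f s ∂μ - ∫ s, f s ∂ν| ≤ tvDist μ ν := by
  have h := integral_sub_integral_le_tvDist μ ν hf.neg fun s => by simpa using h1 s
  simp only [Pi.neg_apply, integral_neg] at h
  exact abs_le.2 ⟨by linarith, integral_sub_integral_le_tvDist μ ν hf h1⟩

theorem tvDist_nonneg : 0 ≤ tvDist μ ν := by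
  simpa using integral_sub_integral_le_tvDist μ ν (f := fun _ => 0) measurable_const (by simp)

theorem abs_integral_sub_integral_le_mul_tvDist {f : S → ℝ} {M : ℝ} (hf : Measurable f)
    (hM : 0 < M) (h1 : ∀ s, |f s| ≤ M) : |∫ s, f s ∂μ - ∫ s, f s ∂ν| ≤ M * tvDist μ ν := by
  have h := abs_integral_sub_integral_le_tvDist μ ν (hf.div_const M) fun s => by
    rw [abs_div, abs_of_pos hM]; exact (div_le_one hM).2 (h1 s)
  rw [integral_div, integral_div, ← sub_div, abs_div, abs_of_pos hM, div_le_iff₀ hM] at h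
  linarith

theorem tendsto_tvDist_of_tendstoUniformly {νs : ℕ → Measure S} [∀ n, IsProbabilityMeasure (νs n)]
    (h : TendstoUniformly (fun n (g : UnitFun S) => ∫ s, g.1 s ∂(νs n))
      (fun g => ∫ s, g.1 s ∂ν) atTop) :
    Tendsto (fun n => tvDist (νs n) ν) atTop (𝓝 0) := by
  rw [Metric.tendstoUniformly_iff] at h
  rw [Metric.tendsto_nhds]
  intro ε hε
  -- Strict bounds for each g give only a weak bound for the supremum, hence ε / 2.
  filter_upwards [h (ε / 2) (by positivity)] with n hn
  rw [Real.dist_eq, sub_zero, abs_of_nonneg (tvDist_nonneg _ _)]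
  refine (tvDist_le (c := ε / 2) fun g => ?_).trans_lt (by linarith)
  have := hn g
  rw [Real.dist_eq, abs_sub_comm] at this
  exact (le_abs_self _).trans this.le

end TotalVariation

theorem TVContinuous.setwiseContinuous {S₁ S₂ : Type*} [MeasurableSpace S₁] [MeasurableSpace S₂]
    [TopologicalSpace S₂] {κ : Kernel S₂ S₁} [IsMarkovKernel κ] (h : TVContinuous κ) :
    SetwiseContinuous κ := by
  rintro u x hu f hf ⟨M, hM⟩
  have hb : ∀ s, |f s| ≤ |M| + 1 := fun s => (hM s).trans (by linarith [le_abs_self M])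
  rw [tendsto_iff_dist_tendsto_zero]
  refine squeeze_zero (fun _ => dist_nonneg) (fun n => ?_)
    (by simpa using (h u x hu).const_mul (|M| + 1))
  rw [Real.dist_eq]
  exact abs_integral_sub_integral_le_mul_tvDist _ _ hf (by positivity) hb

/-- Integrating against a weakly continuous kernel preserves continuity of bounded functions. -/
theorem WeaklyContinuous.continuous_integral {S₁ S₂ : Type*} [TopologicalSpace S₁]
    [MeasurableSpace S₁] [OpensMeasurableSpace S₁] [TopologicalSpace S₂] [SequentialSpace S₂]
    [MeasurableSpace S₂] {κ : Kernel S₂ S₁} [IsMarkovKernel κ] (h : WeaklyContinuous κ)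
    (f : BoundedContinuousFunction S₁ ℝ) : Continuous fun s => ∫ t, f t ∂(κ s) := by
  refine SeqContinuous.continuous fun u x hu => ?_
  exact ProbabilityMeasure.tendsto_iff_forall_integral_tendsto.1 (h u x hu) f

/-! ### Integral formulas for the kernels of the model, and existence of a filter -/

section Model

variable {X Y A : Type*} [MeasurableSpace X] [MeasurableSpace Y] [MeasurableSpace A]

/-- Both parameters are absorbed into a single measure z × δ_a on which the fixed kernel P acts. -/
theorem nextState_eq_comp (P : Kernel (X × A) X) [IsMarkovKernel P] (z : ProbabilityMeasure X)
    (a : A) : nextState P (z, a) = P ∘ₘ ((z : Measure X).prod (Measure.dirac a)) := by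
  ext B hB
  have hm : Measurable fun p : X × A => P p B := P.measurable_coe hB
  rw [Measure.bind_apply hB P.measurable.aemeasurable, lintegral_prod _ hm.aemeasurable]
  have hd : ∀ x, ∫⁻ b, P (x, b) B ∂(Measure.dirac a) = P (x, a) B := fun x =>
    lintegral_dirac' a (hm.comp measurable_prodMk_left)
  simp only [hd]
  rw [nextState, Kernel.snd_apply' _ _ hB, Kernel.compProd_apply (measurable_snd hB)]
  rfl

theorem jointKernel_eq_compProd (P : Kernel (X × A) X) [IsMarkovKernel P]
    (Q : Kernel (A × X) Y) [IsMarkovKernel Q] (z : ProbabilityMeasure X) (a : A) :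
    jointKernel P Q (z, a) =
      nextState P (z, a) ⊗ₘ Q.comap (fun x => (a, x)) measurable_prodMk_left := by
  rw [jointKernel, Measure.compProd, Kernel.compProd_apply_eq_compProd_sectR]
  rfl

/-- Integration against `R` of a product, in terms of `Q` and the law of the next state. -/
theorem integral_jointKernel_mul (P : Kernel (X × A) X) [IsMarkovKernel P]
    (Q : Kernel (A × X) Y) [IsMarkovKernel Q] (z : ProbabilityMeasure X) (a : A)
    {f : X → ℝ} (hf : Measurable f) (hf1 : ∀ x, |f x| ≤ 1) (g : UnitFun Y) :
    ∫ p, f p.1 * g.1 p.2 ∂(jointKernel P Q (z, a)) =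
      ∫ s, f s.2 * ∫ y, g.1 y ∂(Q s) ∂((Measure.dirac a).prod (nextState P (z, a))) := by
  have hm : Measurable fun s : A × X => f s.2 * ∫ y, g.1 y ∂(Q s) :=
    (hf.comp measurable_snd).mul (g.2.1.stronglyMeasurable.integral_kernel).measurable
  have hb : ∀ s : A × X, |f s.2 * ∫ y, g.1 y ∂(Q s)| ≤ 1 := fun s => by
    rw [abs_mul]
    exact mul_le_one₀ (hf1 _) (abs_nonneg _) (abs_integral_le_of_abs_le _ g.abs_le)
  rw [integral_prod _ (integrable_of_abs_le hm hb), integral_dirac' _ _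
    (hm.stronglyMeasurable.integral_prod_right'), jointKernel_eq_compProd,
    Measure.integral_compProd]
  · simp only [integral_const_mul, Kernel.comap_apply]
  · refine integrable_of_abs_le (M := 1)
      ((hf.comp measurable_fst).mul (g.2.1.comp measurable_snd)) fun p => ?_
    rw [abs_mul]
    exact mul_le_one₀ (hf1 _) (abs_nonneg _) (g.abs_le _)

theorem integral_obsKernel (P : Kernel (X × A) X) [IsMarkovKernel P]
    (Q : Kernel (A × X) Y) [IsMarkovKernel Q] (s : ProbabilityMeasure X × A) {g : Y → ℝ}
    (hg : Measurable g) :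
    ∫ y, g y ∂(obsKernel P Q s) = ∫ p, g p.2 ∂(jointKernel P Q s) := by
  rw [obsKernel, Kernel.snd_apply, integral_map measurable_snd.aemeasurable
    hg.aestronglyMeasurable]

/-- Rectangles determine a finite measure, so the filtering identity says that H disintegrates R
over its observation marginal R'. -/
theorem IsFilteringKernel.jointKernel_eq {P : Kernel (X × A) X} [IsMarkovKernel P]
    {Q : Kernel (A × X) Y} [IsMarkovKernel Q] {H : Kernel (ProbabilityMeasure X × A × Y) X}
    [IsMarkovKernel H] (hH : IsFilteringKernel P Q H) (z : ProbabilityMeasure X) (a : A) :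
    jointKernel P Q (z, a) = (obsKernel P Q (z, a) ⊗ₘ
      H.comap (fun y => (z, a, y)) (by fun_prop)).map Prod.swap := by
  refine Measure.ext_prod fun {B C} hB hC => ?_
  rw [Measure.map_apply measurable_swap (hB.prod hC), Set.preimage_swap_prod,
    Measure.compProd_apply_prod hC hB, hH z a B C hB hC]
  rfl

/-- Integration against `R` of a product, in terms of a filtering kernel. -/
theorem IsFilteringKernel.integral_jointKernel_mul {P : Kernel (X × A) X} [IsMarkovKernel P]
    {Q : Kernel (A × X) Y} [IsMarkovKernel Q] {H : Kernel (ProbabilityMeasure X × A × Y) X}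
    [IsMarkovKernel H] (hH : IsFilteringKernel P Q H) (z : ProbabilityMeasure X) (a : A)
    {f : X → ℝ} (hf : Measurable f) (hf1 : ∀ x, |f x| ≤ 1) (g : UnitFun Y) :
    ∫ p, f p.1 * g.1 p.2 ∂(jointKernel P Q (z, a)) =
      ∫ y, g.1 y * ∫ x, f x ∂(H (z, a, y)) ∂(obsKernel P Q (z, a)) := by
  have hm : Measurable fun p : X × Y => f p.1 * g.1 p.2 :=
    (hf.comp measurable_fst).mul (g.2.1.comp measurable_snd)
  rw [hH.jointKernel_eq, integral_map measurable_swap.aemeasurable hm.aestronglyMeasurable,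
    Measure.integral_compProd]
  · simp only [Prod.fst_swap, Prod.snd_swap, integral_mul_const, Kernel.comap_apply, mul_comm]
  · refine integrable_of_abs_le (M := 1) (hm.comp measurable_swap) fun p => ?_
    rw [abs_mul]
    exact mul_le_one₀ (hf1 _) (abs_nonneg _) (g.abs_le _)

theorem measurable_integral_filter (H : Kernel (ProbabilityMeasure X × A × Y) X) {f : X → ℝ}
    (hf : Measurable f) (s : ProbabilityMeasure X × A) :
    Measurable fun y => ∫ x, f x ∂(H (s.1, s.2, y)) :=
  (hf.stronglyMeasurable.integral_kernel (κ := H)).measurable.comp (by fun_prop)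

theorem integral_beliefKernel (P : Kernel (X × A) X) [IsMarkovKernel P]
    (Q : Kernel (A × X) Y) [IsMarkovKernel Q]
    (H : Kernel (ProbabilityMeasure X × A × Y) X) [IsMarkovKernel H]
    (s : ProbabilityMeasure X × A) {F : ProbabilityMeasure X → ℝ} (hF : Measurable F) :
    ∫ m, F m ∂(beliefKernel P Q H s) = ∫ y, F (law H (s.1, s.2, y)) ∂(obsKernel P Q s) := by
  have hm := measurable_law_assoc H
  have hm' : Measurable fun y => law H (s.1, s.2, y) := hm.comp measurable_prodMk_left
  have e : beliefKernel P Q H s = (obsKernel P Q s).map fun y => law H (s.1, s.2, y) := by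
    ext D hD
    rw [beliefKernel_apply P Q H s.1 s.2 hD, Measure.map_apply hm' hD]
    exact lintegral_indicator_one (hm' hD)
  rw [e, integral_map hm'.aemeasurable hF.aestronglyMeasurable]

/-- A filtering kernel exists when the state space is standard Borel. -/
theorem exists_isFilteringKernel [StandardBorelSpace X] [MeasurableSpace.CountablyGenerated Y]
    (P : Kernel (X × A) X) [IsMarkovKernel P] (Q : Kernel (A × X) Y) [IsMarkovKernel Q] :
    ∃ (H : Kernel (ProbabilityMeasure X × A × Y) X) (_ : IsMarkovKernel H),
      IsFilteringKernel P Q H := by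
  -- Conditional kernels need a nonempty target; over an empty X there are no beliefs and everything
  -- is vacuous.
  rcases isEmpty_or_nonempty X with hX | hX
  · have hz : ∀ z : ProbabilityMeasure X, False := fun z => by
      have := z.nonempty
      exact not_nonempty_iff.2 hX this
    exact ⟨0, ⟨fun p => (hz p.1).elim⟩, fun z => (hz z).elim⟩
  -- The coordinates are swapped because `condKernel` conditions on the first one.
  · let κ : Kernel (ProbabilityMeasure X × A) (Y × X) := (jointKernel P Q).swapRight
    refine ⟨κ.condKernel.comap (fun p => ((p.1, p.2.1), p.2.2)) (by fun_prop), inferInstance, ?_⟩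
    intro z a B C hB hC
    have hfst : Kernel.fst κ = obsKernel P Q := by
      rw [Kernel.fst_swapRight, obsKernel]
    have h1 : jointKernel P Q (z, a) (B ×ˢ C) = κ (z, a) (C ×ˢ B) := by
      rw [Kernel.swapRight_apply' _ _ (hC.prod hB)]
      congr 1
      ext p
      simp [and_comm]
    have h2 := congrArg (fun η => η (z, a) (C ×ˢ B)) (κ.disintegrate κ.condKernel)
    simp only [Kernel.compProd_apply_prod hC hB, hfst] at h2
    rw [h1, ← h2]
    rfl

end Model

/-! ### Continuity of R and R' in the belief and the action -/

/-- The integrals of `g` against `Q`, multiplied by a continuous function of the state, form an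
equicontinuous family. -/
theorem TVContinuous.equicontinuous_mul_integral {X Y A : Type*} [TopologicalSpace X]
    [TopologicalSpace.MetrizableSpace X] [MeasurableSpace X] [MeasurableSpace Y]
    [TopologicalSpace A] [TopologicalSpace.MetrizableSpace A] [MeasurableSpace A]
    {Q : Kernel (A × X) Y} [IsMarkovKernel Q] (hQ : TVContinuous Q) {f : X → ℝ}
    (hf : Continuous f) (hf1 : ∀ x, |f x| ≤ 1) :
    Equicontinuous fun (g : UnitFun Y) (s : A × X) => f s.2 * ∫ y, g.1 y ∂(Q s) := by
  intro s
  rw [Metric.equicontinuousAt_iff_right]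
  intro ε hε
  -- One total variation bound controls all g simultaneously.
  have htv : Tendsto (fun t => tvDist (Q t) (Q s)) (𝓝 s) (𝓝 0) :=
    tendsto_of_seq_tendsto fun u hu => hQ u s hu
  have hfs : Tendsto (fun t : A × X => f t.2) (𝓝 s) (𝓝 (f s.2)) :=
    (hf.comp continuous_snd).tendsto s
  filter_upwards [htv.eventually (gt_mem_nhds (half_pos hε)),
    hfs.eventually (Metric.ball_mem_nhds _ (half_pos hε))] with t h1 h2
  intro g
  have h3 := abs_integral_sub_integral_le_tvDist (Q t) (Q s) g.2.1 g.abs_le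
  have h4 := abs_integral_le_of_abs_le (Q s) g.abs_le
  rw [Real.dist_eq] at h2
  rw [dist_comm, Real.dist_eq]
  calc |f t.2 * ∫ y, g.1 y ∂(Q t) - f s.2 * ∫ y, g.1 y ∂(Q s)|
      = |f t.2 * (∫ y, g.1 y ∂(Q t) - ∫ y, g.1 y ∂(Q s)) +
          (f t.2 - f s.2) * ∫ y, g.1 y ∂(Q s)| := by ring_nf
    _ ≤ |f t.2| * |∫ y, g.1 y ∂(Q t) - ∫ y, g.1 y ∂(Q s)| +
          |f t.2 - f s.2| * |∫ y, g.1 y ∂(Q s)| := by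
        rw [← abs_mul, ← abs_mul]; exact abs_add_le _ _
    _ ≤ 1 * tvDist (Q t) (Q s) + |f t.2 - f s.2| * 1 := by
        gcongr
        exact hf1 _
    _ < ε := by linarith

section Topological

variable {X Y A : Type*}
    [TopologicalSpace X] [TopologicalSpace.MetrizableSpace X] [SecondCountableTopology X]
    [MeasurableSpace X] [BorelSpace X] [MeasurableSpace Y]
    [TopologicalSpace A] [TopologicalSpace.MetrizableSpace A] [SecondCountableTopology A]
    [MeasurableSpace A] [BorelSpace A]
    {P : Kernel (X × A) X} [IsMarkovKernel P] {Q : Kernel (A × X) Y} [IsMarkovKernel Q]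

/-- The measure z × δ_a is weakly continuous in (z, a), and integrating a bounded continuous f
against P gives a bounded continuous function on X × A. -/
theorem WeaklyContinuous.nextState (hP : WeaklyContinuous P) :
    WeaklyContinuous (nextState P) := by
  rintro u ⟨z, a⟩ hu
  refine ProbabilityMeasure.tendsto_iff_forall_integral_tendsto.2 fun f => ?_
  have hc := hP.continuous_integral f
  let Pf : BoundedContinuousFunction (X × A) ℝ :=
    .ofNormedAddCommGroup _ hc ‖f‖ fun s => abs_integral_le_of_abs_le _ f.norm_coe_le_norm
  have hnext : ∀ w : ProbabilityMeasure X × A, ∫ x, f x ∂(POMDP.nextState P w) =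
      ∫ s, Pf s ∂(w.1.prod (diracProba w.2) : Measure (X × A)) := by
    rintro ⟨w, b⟩
    rw [nextState_eq_comp, ← Measure.snd_compProd, Measure.snd,
      integral_map measurable_snd.aemeasurable f.continuous.measurable.aestronglyMeasurable,
      Measure.integral_compProd]
    · rfl
    · exact integrable_of_abs_le (f.continuous.measurable.comp measurable_snd)
        fun p => f.norm_coe_le_norm p.2
  have hprod : Tendsto (fun n => (u n).1.prod (diracProba (u n).2)) atTop
      (𝓝 (z.prod (diracProba a))) := by
    have h2 := continuous_diracProba.continuousAt.tendsto.comp hu.snd_nhds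
    exact (ProbabilityMeasure.continuous_prod.tendsto (z, diracProba a)).comp
      (hu.fst_nhds.prodMk_nhds h2)
  have := ProbabilityMeasure.tendsto_iff_forall_integral_tendsto.1 hprod Pf
  simp only [law, ProbabilityMeasure.coe_mk, hnext]
  exact this

/-- For a continuous function `f` of the state, the measures `f(x) R(dx dy | z, a)`, projected to
the observation space, depend on `(z, a)` continuously in total variation. -/
theorem tendstoUniformly_integral_jointKernel (hP : WeaklyContinuous P) (hQ : TVContinuous Q)
    {f : X → ℝ} (hf : Continuous f) (hf1 : ∀ x, |f x| ≤ 1) {u : ℕ → ProbabilityMeasure X × A}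
    {s : ProbabilityMeasure X × A} (hu : Tendsto u atTop (𝓝 s)) :
    TendstoUniformly
      (fun n (g : UnitFun Y) => ∫ p, f p.1 * g.1 p.2 ∂(jointKernel P Q (u n)))
      (fun g => ∫ p, f p.1 * g.1 p.2 ∂(jointKernel P Q s)) atTop := by
  -- With a carried by a Dirac factor, only the measure varies and the integrands stay fixed.
  have hprod : Tendsto (fun n => (diracProba (u n).2).prod (law (nextState P) (u n))) atTop
      (𝓝 ((diracProba s.2).prod (law (nextState P) s))) :=
    (ProbabilityMeasure.continuous_prod.tendsto (diracProba s.2, law (nextState P) s)).comp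
      ((continuous_diracProba.continuousAt.tendsto.comp hu.snd_nhds).prodMk_nhds
        (hP.nextState u s hu))
  have h := tendstoUniformly_integral_of_equicontinuous
    (hQ.equicontinuous_mul_integral hf hf1) (fun g t => by
      rw [abs_mul]
      exact mul_le_one₀ (hf1 _) (abs_nonneg _) (abs_integral_le_of_abs_le _ g.abs_le)) hprod
  have e : ∀ (w : ProbabilityMeasure X × A) (g : UnitFun Y),
      ∫ p, f p.1 * g.1 p.2 ∂(jointKernel P Q w) =
        ∫ t, f t.2 * ∫ y, g.1 y ∂(Q t) ∂((diracProba w.2).prod (law (nextState P) w) :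
          Measure (A × X)) := fun w g =>
    integral_jointKernel_mul P Q w.1 w.2 hf.measurable hf1 g
  simp only [e]
  exact h

theorem tvContinuous_obsKernel (hP : WeaklyContinuous P) (hQ : TVContinuous Q) :
    TVContinuous (obsKernel P Q) := by
  intro u s hu
  have h := tendstoUniformly_integral_jointKernel hP hQ (f := fun _ => 1) continuous_const
    (by simp) hu
  refine tendsto_tvDist_of_tendstoUniformly _ ?_
  have e : ∀ (w : ProbabilityMeasure X × A) (g : UnitFun Y),
      ∫ y, g.1 y ∂(obsKernel P Q w) = ∫ p, 1 * g.1 p.2 ∂(jointKernel P Q w) := fun w g => by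
    rw [integral_obsKernel P Q w g.2.1]; simp only [one_mul]
  simp only [e]
  exact h

/-! ### Convergence of the filters and of the belief kernel -/

/-- The filtered expectations of a continuous function of the state converge in `L¹`. -/
theorem IsFilteringKernel.tendsto_integral_abs_sub (hP : WeaklyContinuous P)
    (hQ : TVContinuous Q) {H : Kernel (ProbabilityMeasure X × A × Y) X} [IsMarkovKernel H]
    (hH : IsFilteringKernel P Q H) {f : X → ℝ} (hf : Continuous f) (hf1 : ∀ x, |f x| ≤ 1)
    {u : ℕ → ProbabilityMeasure X × A} {s : ProbabilityMeasure X × A}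
    (hu : Tendsto u atTop (𝓝 s)) :
    Tendsto (fun n => ∫ y, |∫ x, f x ∂(H ((u n).1, (u n).2, y)) - ∫ x, f x ∂(H (s.1, s.2, y))|
      ∂(obsKernel P Q s)) atTop (𝓝 0) := by
  let G : ProbabilityMeasure X × A → Y → ℝ := fun w y => ∫ x, f x ∂(H (w.1, w.2, y))
  have hGm : ∀ w, Measurable (G w) := fun w => measurable_integral_filter H hf.measurable w
  have hG1 : ∀ w y, |G w y| ≤ 1 := fun w y => abs_integral_le_of_abs_le _ hf1
  have hunif := Metric.tendstoUniformly_iff.1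
    (tendstoUniformly_integral_jointKernel hP hQ hf hf1 hu)
  have hjoint : ∀ (w : ProbabilityMeasure X × A) (g : UnitFun Y),
      ∫ p, f p.1 * g.1 p.2 ∂(jointKernel P Q w) = ∫ y, g.1 y * G w y ∂(obsKernel P Q w) :=
    fun w g => hH.integral_jointKernel_mul w.1 w.2 hf.measurable hf1 g
  simp only [hjoint] at hunif
  rw [Metric.tendsto_nhds]
  intro ε hε
  filter_upwards [hunif (ε / 2) (half_pos hε),
    (tvContinuous_obsKernel hP hQ u s hu).eventually (gt_mem_nhds (half_pos hε))] with n h1 h2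
  -- The sign of the difference turns its integral into an L¹ norm. It depends on n, which
  -- uniformity in g permits.
  let g : UnitFun Y := ⟨fun y => if G s y ≤ G (u n) y then 1 else -1,
    Measurable.ite (measurableSet_le (hGm s) (hGm (u n))) measurable_const measurable_const,
    fun y => by dsimp only; split_ifs <;> norm_num⟩
  have hgG : ∀ w, Measurable fun y => g.1 y * G w y := fun w => g.2.1.mul (hGm w)
  have hgG1 : ∀ w y, |g.1 y * G w y| ≤ 1 := fun w y => by
    rw [abs_mul]; exact mul_le_one₀ (g.abs_le y) (abs_nonneg _) (hG1 w y)
  have habs : ∀ y, |G (u n) y - G s y| = g.1 y * G (u n) y - g.1 y * G s y := by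
    intro y
    by_cases hy : G s y ≤ G (u n) y
    · simp [g, hy, abs_of_nonneg (sub_nonneg.2 hy)]
    · rw [abs_of_nonpos (by linarith)]
      simp only [g, hy, if_false]
      ring
  have e : ∫ y, |G (u n) y - G s y| ∂(obsKernel P Q s) =
      ∫ y, g.1 y * G (u n) y ∂(obsKernel P Q s) - ∫ y, g.1 y * G s y ∂(obsKernel P Q s) := by
    simp only [habs]
    exact integral_sub (integrable_of_abs_le (hgG _) (hgG1 _))
      (integrable_of_abs_le (hgG _) (hgG1 _))
  -- Replacing R' at u n by R' at s costs at most their total variation distance, the other half of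
  -- ε.
  have h3 := abs_le.1 (abs_integral_sub_integral_le_tvDist (obsKernel P Q (u n))
    (obsKernel P Q s) (hgG (u n)) (hgG1 (u n)))
  have h4 := h1 g
  rw [Real.dist_eq, abs_lt] at h4
  rw [Real.dist_eq, sub_zero, abs_of_nonneg (integral_nonneg fun _ => abs_nonneg _)]
  change ∫ y, |G (u n) y - G s y| ∂(obsKernel P Q s) < ε
  rw [e]
  linarith [h3.1, h4.1]

/-- Every filtering kernel has the subsequence property of Assumption (H). -/
theorem IsFilteringKernel.exists_subseq_tendsto_ae (hP : WeaklyContinuous P)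
    (hQ : TVContinuous Q) {H : Kernel (ProbabilityMeasure X × A × Y) X} [IsMarkovKernel H]
    (hH : IsFilteringKernel P Q H) {u : ℕ → ProbabilityMeasure X × A}
    {s : ProbabilityMeasure X × A} (hu : Tendsto u atTop (𝓝 s)) :
    ∃ φ : ℕ → ℕ, StrictMono φ ∧ ∀ᵐ y ∂(obsKernel P Q s),
      Tendsto (fun k => law H ((u (φ k)).1, (u (φ k)).2, y)) atTop (𝓝 (law H (s.1, s.2, y))) := by
  obtain ⟨f, hfc, hf01, hfd⟩ := exists_seq_convergence_determining X
  have hf1 : ∀ k x, |f k x| ≤ 1 := fun k x =>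
    abs_le.2 ⟨by linarith [(hf01 k x).1], (hf01 k x).2⟩
  let D : ℕ → ℕ → Y → ℝ := fun j n y =>
    |∫ x, f j x ∂(H ((u n).1, (u n).2, y)) - ∫ x, f j x ∂(H (s.1, s.2, y))|
  have hDm : ∀ j n, Measurable (D j n) := fun j n =>
    ((measurable_integral_filter H (hfc j).measurable (u n)).sub
      (measurable_integral_filter H (hfc j).measurable s)).abs
  have hDi : ∀ j n, Integrable (D j n) (obsKernel P Q s) := fun j n =>
    ((integrable_of_abs_le (measurable_integral_filter H (hfc j).measurable (u n))
      fun y => abs_integral_le_of_abs_le _ (hf1 j)).sub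
    (integrable_of_abs_le (measurable_integral_filter H (hfc j).measurable s)
      fun y => abs_integral_le_of_abs_le _ (hf1 j))).abs
  -- Diagonal choice: stage k makes the first k + 1 test functions accurate to 2⁻ᵏ in L¹.
  have hev : ∀ k, ∀ᶠ n in atTop, ∀ j ∈ Finset.range (k + 1),
      ∫ y, D j n y ∂(obsKernel P Q s) < (1 / 2 : ℝ) ^ k := fun k =>
    (Finset.eventually_all _).2 fun j _ =>
      (hH.tendsto_integral_abs_sub hP hQ (hfc j) (hf1 j) hu).eventually
        (gt_mem_nhds (by positivity))
  obtain ⟨φ, hφ, hφk⟩ := extraction_forall_of_eventually hev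
  refine ⟨φ, hφ, ?_⟩
  have hj : ∀ j, ∀ᵐ y ∂(obsKernel P Q s), Tendsto (fun k => D j (φ k) y) atTop (𝓝 0) := by
    intro j
    -- The j-th function is controlled only from stage j on, hence the shift. Summable integrals
    -- then force an almost surely finite sum, whose terms tend to 0.
    have hle : ∀ k, ∫⁻ y, ENNReal.ofReal (D j (φ (k + j)) y) ∂(obsKernel P Q s) ≤
        ENNReal.ofReal ((1 / 2) ^ k) := by
      intro k
      rw [← ofReal_integral_eq_lintegral_ofReal (hDi j _) (ae_of_all _ fun _ => abs_nonneg _)]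
      refine ENNReal.ofReal_le_ofReal ((hφk (k + j) j (by simp)).le.trans ?_)
      exact pow_le_pow_of_le_one (by norm_num) (by norm_num) (Nat.le_add_right k j)
    have hfin : ∫⁻ y, ∑' k, ENNReal.ofReal (D j (φ (k + j)) y) ∂(obsKernel P Q s) ≠ ⊤ := by
      rw [lintegral_tsum fun k => (hDm j _).ennreal_ofReal.aemeasurable]
      refine ((ENNReal.tsum_le_tsum hle).trans_lt ?_).ne
      rw [← ENNReal.ofReal_tsum_of_nonneg (fun k => by positivity) summable_geometric_two]
      exact ENNReal.ofReal_lt_top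
    filter_upwards [ae_lt_top' (AEMeasurable.tsum fun k =>
      (hDm j _).ennreal_ofReal.aemeasurable) hfin] with y hy
    have h0 := ENNReal.tendsto_atTop_zero_of_tsum_ne_top hy.ne
    rw [← tendsto_add_atTop_iff_nat j]
    have h1 := (ENNReal.tendsto_toReal ENNReal.zero_ne_top).comp h0
    simpa [Function.comp_def, ENNReal.toReal_ofReal, D] using h1
  filter_upwards [ae_all_iff.2 hj] with y hy
  refine hfd _ _ fun j => ?_
  rw [tendsto_iff_dist_tendsto_zero]
  exact hy j

theorem IsFilteringKernel.assumptionH (hP : WeaklyContinuous P) (hQ : TVContinuous Q)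
    {H : Kernel (ProbabilityMeasure X × A × Y) X} [IsMarkovKernel H]
    (hH : IsFilteringKernel P Q H) : AssumptionH P Q := by
  refine ⟨H, inferInstance, hH, fun zs z as a hz ha => ?_⟩
  obtain ⟨φ, hφ, hae⟩ := hH.exists_subseq_tendsto_ae hP hQ (hz.prodMk_nhds ha)
  -- The exceptional set need not be measurable as given; a measurable null superset supplies the
  -- set C as its complement.
  obtain ⟨N, hsub, hN, hN0⟩ := exists_measurable_superset_of_null (ae_iff.1 hae)
  refine ⟨φ, hφ, Nᶜ, hN.compl, (prob_compl_eq_one_iff hN).2 hN0, fun y hy => ?_⟩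
  by_contra hcon
  exact hy (hsub hcon)

/-- In ∫ F(H(z, a, y)) R'(dy | z, a) both integrand and measure move. Total variation freezes the
measure at the limit, and almost sure convergence of the filters handles the integrand. -/
theorem IsFilteringKernel.weaklyContinuous_beliefKernel (hP : WeaklyContinuous P)
    (hQ : TVContinuous Q) {H : Kernel (ProbabilityMeasure X × A × Y) X} [IsMarkovKernel H]
    (hH : IsFilteringKernel P Q H) : WeaklyContinuous (beliefKernel P Q H) := by
  intro u s hu
  refine ProbabilityMeasure.tendsto_iff_forall_integral_tendsto.2 fun F => ?_
  simp only [law, ProbabilityMeasure.coe_mk]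
  simp only [integral_beliefKernel P Q H _ F.continuous.measurable]
  -- The filters converge only along subsequences, but the limit is always the same, so the full
  -- sequence of integrals converges.
  refine tendsto_of_subseq_tendsto fun ns hns => ?_
  have hv := hu.comp hns
  obtain ⟨φ, hφ, hae⟩ := hH.exists_subseq_tendsto_ae hP hQ hv
  refine ⟨φ, ?_⟩
  let v : ℕ → ProbabilityMeasure X × A := fun k => u (ns (φ k))
  have hv' : Tendsto v atTop (𝓝 s) := hv.comp hφ.tendsto_atTop
  have hm : ∀ w : ProbabilityMeasure X × A, Measurable fun y => F (law H (w.1, w.2, y)) :=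
    fun w => F.continuous.measurable.comp
      ((measurable_law_assoc H).comp (measurable_prodMk_left (x := w)))
  have hlim : Tendsto (fun k => ∫ y, F (law H ((v k).1, (v k).2, y)) ∂(obsKernel P Q s)) atTop
      (𝓝 (∫ y, F (law H (s.1, s.2, y)) ∂(obsKernel P Q s))) := by
    refine tendsto_integral_of_dominated_convergence (fun _ => ‖F‖)
      (fun k => (hm (v k)).aestronglyMeasurable) (integrable_const _)
      (fun k => ae_of_all _ fun y => F.norm_coe_le_norm _) ?_
    filter_upwards [hae] with y hy
    exact (F.continuous.tendsto _).comp hy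
  have hdiff : Tendsto (fun k => ∫ y, F (law H ((v k).1, (v k).2, y)) ∂(obsKernel P Q (v k)) -
      ∫ y, F (law H ((v k).1, (v k).2, y)) ∂(obsKernel P Q s)) atTop (𝓝 0) := by
    refine squeeze_zero_norm (fun k => ?_)
      (by simpa using (tvContinuous_obsKernel hP hQ v s hv').const_mul (‖F‖ + 1))
    exact abs_integral_sub_integral_le_mul_tvDist _ _ (hm (v k)) (by positivity)
      fun y => (F.norm_coe_le_norm _).trans (by linarith)
  simpa using hdiff.add hlim

end Topological

end POMDP

theorem theorem3p7
    {X Y A : Type*}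
    [TopologicalSpace X] [TopologicalSpace.MetrizableSpace X] [SecondCountableTopology X]
    [MeasurableSpace X] [BorelSpace X] [StandardBorelSpace X]
    [TopologicalSpace Y] [TopologicalSpace.MetrizableSpace Y] [SecondCountableTopology Y]
    [MeasurableSpace Y] [BorelSpace Y] [StandardBorelSpace Y]
    [TopologicalSpace A] [TopologicalSpace.MetrizableSpace A] [SecondCountableTopology A]
    [MeasurableSpace A] [BorelSpace A] [StandardBorelSpace A]
    (P : Kernel (X × A) X) [IsMarkovKernel P]
    (Q : Kernel (A × X) Y) [IsMarkovKernel Q]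
    (hP : POMDP.WeaklyContinuous P) (hQ : POMDP.TVContinuous Q) :
    POMDP.SetwiseContinuous (POMDP.obsKernel P Q) ∧
    POMDP.TVContinuous (POMDP.obsKernel P Q) ∧
    POMDP.AssumptionH P Q ∧
    ∀ (H : Kernel (ProbabilityMeasure X × A × Y) X) [IsMarkovKernel H],
      POMDP.IsFilteringKernel P Q H → POMDP.WeaklyContinuous (POMDP.beliefKernel P Q H) := by
  have hR := POMDP.tvContinuous_obsKernel hP hQ
  obtain ⟨H, hH, hfilter⟩ := POMDP.exists_isFilteringKernel P Q
  exact ⟨hR.setwiseContinuous, hR, hfilter.assumptionH hP hQ,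
    fun H _ hH => hH.weaklyContinuous_beliefKernel hP hQ⟩
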